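/- For all sufficiently large real $C$ the following holds with $c = 1/(4\log C) > 0$ and $c_2 = C^{-24} > 0$, where $\log$ is the natural logarithm. Let $k \ge C^8$ be an integer and let $d$ be $c\log k$ rounded up or down to an integer, i.e. $d\in\mathbb{N}$ and $|d - c\log k| < 1$. For $\mu_1,\dots,\mu_k \in \mathbb{R}^d$, the standard mixture with means $\mu_1,\dots,\mu_k$ is the uniform mixture of the $k$ spherical Gaussians with these means and covariance $\frac{1}{2\pi} I_d$; its density is $f_\mu(x) = \frac1k \sum_{j=1}^k e^{-\pi \|x-\mu_j\|_2^2}$. Pick $\mu_1,\dots,\mu_k$ independently and uniformly from the ball of radius $\sqrt d$ around the origin of $\mathbb{R}^d$. Then with probability at least $1 - 2/k$ there is another standard mixture of $k$ spherical Gaussians in $\mathbb{R}^d$, with means $\tilde\mu_1,\dots,\tilde\mu_k$, such that: - both mixtures are $\sqrt d$-bounded: $\|\mu_j\|_2 \le \sqrt d$ and $\|\tilde\mu_j\|_2 \le \sqrt d$ for all $j$; - both are well separated: $\|\mu_i - \mu_j\|_2 \ge c_2\sqrt{\log k}$ and $\|\tilde\mu_i - \tilde\mu_j\|_2 \ge c_2\sqrt{\log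 k}$ for all $i \ne j$; - their densities are close: $\|f_\mu - f_{\tilde\mu}\|_1 = \int_{\mathbb{R}^d} |f_\mu - f_{\tilde\mu}|\,dx \le k^{-C}$; - their parameter distance is large: $\min_{\pi} \sum_{j=1}^k \|\mu_j - \tilde\mu_{\pi(j)}\|_2 \ge c_2\sqrt{\log k}$, the minimum being over all permutations $\pi$ of $\{1,\dots,k\}$. -/

import Mathlib

open MeasureTheory

noncomputable section

/-- The p.d.f. of the spherical Gaussian on `ℝᵈ` with mean `μ` and covariance `σ² / (2π) • I`. -/
def sphericalGaussianPdf {d : ℕ} (μ : EuclideanSpace ℝ (Fin d)) (σ : ℝ)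
    (x : EuclideanSpace ℝ (Fin d)) : ℝ :=
  (σ ^ d)⁻¹ * Real.exp (-Real.pi * ‖x - μ‖ ^ 2 / σ ^ 2)

/-- The p.d.f. of the standard mixture of `k` spherical Gaussians with means `μ 0, …, μ (k - 1)`:
all weights are `1 / k` and all the parameters `σ` are `1`. -/
def standardMixturePdf {k d : ℕ} (μ : Fin k → EuclideanSpace ℝ (Fin d))
    (x : EuclideanSpace ℝ (Fin d)) : ℝ :=
  ∑ j, (1 / (k : ℝ)) * sphericalGaussianPdf (μ j) 1 x

/-- A standard mixture is `ρ`-bounded if all its means have Euclidean length at most `ρ`. -/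
def IsBoundedMixture {k d : ℕ} (ρ : ℝ) (μ : Fin k → EuclideanSpace ℝ (Fin d)) : Prop :=
  ∀ j, ‖μ j‖ ≤ ρ

/-- Any two distinct components have means at distance at least `s`. -/
def IsSeparatedMixture {k d : ℕ} (s : ℝ) (μ : Fin k → EuclideanSpace ℝ (Fin d)) : Prop :=
  ∀ i j, i ≠ j → s ≤ ‖μ i - μ j‖

/-- The parameter distance of two standard mixtures: the minimum over all matchings `π` of the
components of the sum of the distances between matched means. -/
def paramDist {k d : ℕ} (μ ν : Fin k → EuclideanSpace ℝ (Fin d)) : ℝ :=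
  Finset.univ.inf' Finset.univ_nonempty
    (fun π : Equiv.Perm (Fin k) => ∑ j, ‖μ j - ν (π j)‖)

/-- The law of `k` means picked independently and uniformly (with respect to Lebesgue measure) from
the ball of radius `√d` around the origin of `ℝᵈ`. -/
def randomMeans (k d : ℕ) : Measure (Fin k → EuclideanSpace ℝ (Fin d)) :=
  Measure.pi (fun _ => ProbabilityTheory.cond volume
    (Metric.closedBall (0 : EuclideanSpace ℝ (Fin d)) (Real.sqrt d)))

end

/-! The proof is a pigeonhole argument on moments. Relative to `exp (-π ‖x‖²)`, the mixture density
is an average of `exp (-π ‖μ j‖²) * exp (2π ⟪x, μ j⟫)`. Truncating the last exponential at degree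
`l` leaves a polynomial in `x` determined by the weighted moments of degree below `l`, so mixtures
whose moments agree up to `η` have close densities (`eLpNorm_standardMixturePdf_sub_le`).

Rounding the moments at scale `1 / Q` sorts the mixtures into cells. For fixed `μ`, a random mixture
is within parameter distance `s` of `μ` with probability at most `k! * r ^ k`, where `r` bounds the
mass of a ball of radius `s` (`measure_pi_paramDist_lt_le`). A cell heavier than this cannot lie
inside the neighbourhood of any of its points, so each of its points has a far partner in the same
cell; the light cells together have small mass (`measure_exists_same_value_not_mem`).

In dimension about `log k / (4 log C)` there are far fewer than `k` moments, so the number of cells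
is beaten by `k! * r ^ k` (`cells_bound`). Non-separated mixtures cost another `1 / k`. -/

/-! ### Close moments give close densities -/

/-- In the tail all exponents are at least `l`, so replacing `|t|` by `2 * |t|` gains a factor `2 ^
l` in every term. -/
theorem abs_exp_sub_sum_range_le (t : ℝ) (l : ℕ) :
    |Real.exp t - ∑ n ∈ Finset.range l, t ^ n / (n.factorial : ℝ)|
      ≤ (1 / 2) ^ l * Real.exp (2 * |t|) := by
  have hexp : ∀ s : ℝ, Real.exp s = ∑' n : ℕ, s ^ n / (n.factorial : ℝ) := fun s => by
    rw [Real.exp_eq_exp_ℝ, NormedSpace.exp_eq_tsum_div]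
  have hs := fun s : ℝ => Real.summable_pow_div_factorial s
  have hsplit := fun s : ℝ => (hs s).sum_add_tsum_nat_add l
  have h1 : Real.exp t - ∑ n ∈ Finset.range l, t ^ n / (n.factorial : ℝ)
      = ∑' n : ℕ, t ^ (n + l) / ((n + l).factorial : ℝ) := by
    rw [hexp, ← hsplit t]; ring
  have hsh : Summable fun n : ℕ => (2 * |t|) ^ (n + l) / ((n + l).factorial : ℝ) :=
    (summable_nat_add_iff l).2 (hs (2 * |t|))
  have h2 : ∑' n : ℕ, (2 * |t|) ^ (n + l) / ((n + l).factorial : ℝ) ≤ Real.exp (2 * |t|) := by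
    rw [hexp, ← hsplit (2 * |t|)]
    have : 0 ≤ ∑ n ∈ Finset.range l, (2 * |t|) ^ n / (n.factorial : ℝ) :=
      Finset.sum_nonneg fun n _ => by positivity
    linarith
  rw [h1, ← Real.norm_eq_abs]
  refine (tsum_of_norm_bounded (hsh.mul_left ((1 / 2 : ℝ) ^ l)).hasSum fun n => ?_).trans ?_
  · rw [Real.norm_eq_abs, abs_div, abs_pow, Nat.abs_cast, ← mul_div_assoc]
    gcongr
    rw [mul_pow, ← mul_assoc]
    have : (1 : ℝ) ≤ (1 / 2) ^ l * 2 ^ (n + l) := by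
      rw [pow_add, mul_comm, mul_assoc, ← mul_pow]; norm_num
      exact one_le_pow₀ (by norm_num)
    exact le_mul_of_one_le_left (by positivity) this
  · rw [tsum_mul_left]; gcongr

/-- The moments of the measure `1 / k * ∑ j, exp (-π ‖μ j‖²) δ_(μ j / R)`. -/
noncomputable def gaussMoment {k d : ℕ} (R : ℝ) (μ : Fin k → EuclideanSpace ℝ (Fin d)) {n : ℕ}
    (a : Sym (Fin d) n) : ℝ :=
  ∑ j, 1 / (k : ℝ) * (Real.exp (-Real.pi * ‖μ j‖ ^ 2) * (a.val.map fun i => μ j i / R).prod)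

theorem abs_prod_map {α : Type*} (s : Multiset α) (f : α → ℝ) :
    |(s.map f).prod| = (s.map fun a => |f a|).prod := by
  induction s using Multiset.induction with
  | empty => simp
  | cons a s ih => rw [Multiset.map_cons, Multiset.prod_cons, abs_mul, ih, Multiset.map_cons,
      Multiset.prod_cons]

theorem abs_prod_map_le_one {α : Type*} (s : Multiset α) (f : α → ℝ) (h : ∀ a, |f a| ≤ 1) :
    |(s.map f).prod| ≤ 1 := by
  induction s using Multiset.induction with
  | empty => simp
  | cons a s ih =>
    rw [Multiset.map_cons, Multiset.prod_cons, abs_mul]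
    exact mul_le_one₀ (h a) (abs_nonneg _) ih

theorem sum_abs_le_sqrt_mul_norm {d : ℕ} (x : EuclideanSpace ℝ (Fin d)) :
    ∑ i, |x i| ≤ Real.sqrt d * ‖x‖ := by
  refine abs_le_of_sq_le_sq' ?_ (by positivity) |>.2
  rw [mul_pow, Real.sq_sqrt (Nat.cast_nonneg d), EuclideanSpace.norm_sq_eq]
  simpa using sq_sum_le_card_mul_sum_sq (s := Finset.univ) (f := fun i => |x i|)

theorem abs_sum_average_le {k : ℕ} (f : Fin k → ℝ) {B : ℝ} (hB : 0 ≤ B) (h : ∀ j, |f j| ≤ B) :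
    |∑ j, 1 / (k : ℝ) * f j| ≤ B := by
  refine (Finset.abs_sum_le_sum_abs _ _).trans ?_
  calc ∑ j, |1 / (k : ℝ) * f j| ≤ ∑ _j : Fin k, 1 / (k : ℝ) * B := by
        refine Finset.sum_le_sum fun j _ => ?_
        rw [abs_mul, abs_of_nonneg (by positivity : (0 : ℝ) ≤ 1 / k)]
        exact mul_le_mul_of_nonneg_left (h j) (by positivity)
    _ ≤ B := by
        rcases Nat.eq_zero_or_pos k with rfl | hk
        · simpa using hB
        · have : (k : ℝ) ≠ 0 := by positivity
          simp only [Finset.sum_const, Finset.card_univ, Fintype.card_fin, nsmul_eq_mul]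
          field_simp; rfl

theorem exp_neg_pi_mul_sq_le_one (r : ℝ) : Real.exp (-Real.pi * r ^ 2) ≤ 1 := by
  rw [Real.exp_le_one_iff]
  have := mul_nonneg Real.pi_pos.le (sq_nonneg r)
  linarith

theorem abs_gaussMoment_le_one {k d : ℕ} {R : ℝ} (hR : 0 < R)
    {μ : Fin k → EuclideanSpace ℝ (Fin d)} (hμ : IsBoundedMixture R μ) {n : ℕ}
    (a : Sym (Fin d) n) : |gaussMoment R μ a| ≤ 1 := by
  refine abs_sum_average_le _ zero_le_one fun j => ?_
  rw [abs_mul, Real.abs_exp]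
  refine mul_le_one₀ (exp_neg_pi_mul_sq_le_one _) (abs_nonneg _) (abs_prod_map_le_one _ _ fun i => ?_)
  rw [abs_div, abs_of_pos hR, div_le_one hR]
  exact (PiLp.norm_apply_le (μ j) i).trans (hμ j)

/-- Multinomial expansion of the inner product, with `R` moved from the means to `x` so that the
moments stay bounded by 1. -/
theorem sum_average_inner_pow {k d : ℕ} {R : ℝ} (hR : R ≠ 0)
    (μ : Fin k → EuclideanSpace ℝ (Fin d)) (x : EuclideanSpace ℝ (Fin d)) (n : ℕ) :
    ∑ j, 1 / (k : ℝ) * (Real.exp (-Real.pi * ‖μ j‖ ^ 2) * inner ℝ x (μ j) ^ n)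
      = ∑ a : Sym (Fin d) n, (a.val.countPerms : ℝ) * (a.val.map fun i => R * x i).prod
          * gaussMoment R μ a := by
  have h : ∀ j, inner ℝ x (μ j) ^ n = ∑ a : Sym (Fin d) n, (a.val.countPerms : ℝ) *
      ((a.val.map fun i => R * x i).prod * (a.val.map fun i => μ j i / R).prod) := by
    intro j
    have : inner ℝ x (μ j) = ∑ i, (R * x i) * (μ j i / R) := by
      rw [PiLp.inner_apply]
      refine Finset.sum_congr rfl fun i _ => ?_
      simp only [RCLike.inner_apply, conj_trivial]
      field_simp
    rw [this, Finset.sum_pow, Finset.sym_univ]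
    simp only [Multiset.prod_map_mul]
  simp only [h, gaussMoment, Finset.mul_sum]
  rw [Finset.sum_comm]
  refine Finset.sum_congr rfl fun a _ => Finset.sum_congr rfl fun j _ => ?_
  ring

theorem abs_sum_average_inner_pow_sub_le {k d : ℕ} {R η : ℝ} (hR : 0 < R) (hη : 0 ≤ η)
    (μ ν : Fin k → EuclideanSpace ℝ (Fin d)) (x : EuclideanSpace ℝ (Fin d)) (n : ℕ)
    (h : ∀ a : Sym (Fin d) n, |gaussMoment R μ a - gaussMoment R ν a| ≤ η) :
    |∑ j, 1 / (k : ℝ) * (Real.exp (-Real.pi * ‖μ j‖ ^ 2) * inner ℝ x (μ j) ^ n)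
      - ∑ j, 1 / (k : ℝ) * (Real.exp (-Real.pi * ‖ν j‖ ^ 2) * inner ℝ x (ν j) ^ n)|
      ≤ η * (R * Real.sqrt d * ‖x‖) ^ n := by
  rw [sum_average_inner_pow hR.ne', sum_average_inner_pow hR.ne', ← Finset.sum_sub_distrib]
  have hsum : (∑ i, R * |x i|) ^ n = ∑ a : Sym (Fin d) n, (a.val.countPerms : ℝ) *
      |(a.val.map fun i => R * x i).prod| := by
    rw [Finset.sum_pow, Finset.sym_univ]
    refine Finset.sum_congr rfl fun a _ => ?_
    congr 1
    rw [abs_prod_map]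
    simp only [abs_mul, abs_of_pos hR]
  calc _ ≤ ∑ a : Sym (Fin d) n, |(a.val.countPerms : ℝ) * (a.val.map fun i => R * x i).prod
          * gaussMoment R μ a - (a.val.countPerms : ℝ) * (a.val.map fun i => R * x i).prod
          * gaussMoment R ν a| := Finset.abs_sum_le_sum_abs _ _
    _ ≤ ∑ a : Sym (Fin d) n, η * ((a.val.countPerms : ℝ) *
      |(a.val.map fun i => R * x i).prod|) := by
        refine Finset.sum_le_sum fun a _ => ?_
        rw [← mul_sub, abs_mul, abs_mul, Nat.abs_cast, mul_comm]
        exact mul_le_mul_of_nonneg_right (h a) (by positivity)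
    _ = η * (∑ i, R * |x i|) ^ n := by rw [hsum, Finset.mul_sum]
    _ ≤ η * (R * Real.sqrt d * ‖x‖) ^ n := by
        gcongr
        rw [← Finset.mul_sum, mul_assoc]
        exact mul_le_mul_of_nonneg_left (sum_abs_le_sqrt_mul_norm x) hR.le

theorem standardMixturePdf_eq {k d : ℕ} (μ : Fin k → EuclideanSpace ℝ (Fin d))
    (x : EuclideanSpace ℝ (Fin d)) :
    standardMixturePdf μ x = Real.exp (-Real.pi * ‖x‖ ^ 2) * ∑ j, 1 / (k : ℝ) *
      (Real.exp (-Real.pi * ‖μ j‖ ^ 2) * Real.exp (2 * Real.pi * inner ℝ x (μ j))) := by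
  rw [standardMixturePdf, Finset.mul_sum]
  refine Finset.sum_congr rfl fun j _ => ?_
  rw [mul_left_comm, ← Real.exp_add, ← Real.exp_add, sphericalGaussianPdf, norm_sub_sq_real,
    one_pow, one_pow, inv_one, one_mul, div_one]
  congr 2
  ring

/-- The Taylor polynomial of degree less than `l` of the mixture density relative to the standard
Gaussian. -/
noncomputable def mixtureTaylor {k d : ℕ} (l : ℕ) (μ : Fin k → EuclideanSpace ℝ (Fin d))
    (x : EuclideanSpace ℝ (Fin d)) : ℝ :=
  ∑ n ∈ Finset.range l, (2 * Real.pi) ^ n / (n.factorial : ℝ) *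
    ∑ j, 1 / (k : ℝ) * (Real.exp (-Real.pi * ‖μ j‖ ^ 2) * inner ℝ x (μ j) ^ n)

theorem abs_average_sub_mixtureTaylor_le {k d : ℕ} {R : ℝ} (l : ℕ)
    {μ : Fin k → EuclideanSpace ℝ (Fin d)} (hμ : IsBoundedMixture R μ)
    (x : EuclideanSpace ℝ (Fin d)) :
    |∑ j, 1 / (k : ℝ) *
        (Real.exp (-Real.pi * ‖μ j‖ ^ 2) * Real.exp (2 * Real.pi * inner ℝ x (μ j)))
      - mixtureTaylor l μ x| ≤ (1 / 2) ^ l * Real.exp (4 * Real.pi * R * ‖x‖) := by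
  have h : mixtureTaylor l μ x = ∑ j, 1 / (k : ℝ) * (Real.exp (-Real.pi * ‖μ j‖ ^ 2) *
      ∑ n ∈ Finset.range l, (2 * Real.pi * inner ℝ x (μ j)) ^ n / (n.factorial : ℝ)) := by
    simp only [mixtureTaylor, Finset.mul_sum]
    rw [Finset.sum_comm]
    refine Finset.sum_congr rfl fun j _ => Finset.sum_congr rfl fun n _ => ?_
    rw [mul_pow]; ring
  rw [h, ← Finset.sum_sub_distrib]
  simp only [← mul_sub]
  refine abs_sum_average_le _ (by positivity) fun j => ?_
  rw [abs_mul, Real.abs_exp]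
  refine (mul_le_of_le_one_left (abs_nonneg _) (exp_neg_pi_mul_sq_le_one _)).trans ?_
  refine (abs_exp_sub_sum_range_le _ _).trans ?_
  refine mul_le_mul_of_nonneg_left (Real.exp_le_exp.2 ?_) (by positivity)
  rw [abs_mul, abs_of_pos Real.two_pi_pos]
  have h1 : |inner ℝ x (μ j)| ≤ ‖x‖ * R :=
    (abs_real_inner_le_norm _ _).trans (mul_le_mul_of_nonneg_left (hμ j) (norm_nonneg _))
  have := mul_le_mul_of_nonneg_left h1 Real.pi_pos.le
  linarith

theorem abs_mixtureTaylor_sub_le {k d : ℕ} {R η : ℝ} (hR : 0 < R) (hη : 0 ≤ η) (l : ℕ)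
    (μ ν : Fin k → EuclideanSpace ℝ (Fin d)) (x : EuclideanSpace ℝ (Fin d))
    (h : ∀ n < l, ∀ a : Sym (Fin d) n, |gaussMoment R μ a - gaussMoment R ν a| ≤ η) :
    |mixtureTaylor l μ x - mixtureTaylor l ν x|
      ≤ η * Real.exp (2 * Real.pi * (R * Real.sqrt d * ‖x‖)) := by
  rw [mixtureTaylor, mixtureTaylor, ← Finset.sum_sub_distrib]
  simp only [← mul_sub]
  calc _ ≤ ∑ n ∈ Finset.range l, η * ((2 * Real.pi * (R * Real.sqrt d * ‖x‖)) ^ n /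
          (n.factorial : ℝ)) := by
        refine (Finset.abs_sum_le_sum_abs _ _).trans (Finset.sum_le_sum fun n hn => ?_)
        rw [abs_mul, abs_of_nonneg (by positivity)]
        refine (mul_le_mul_of_nonneg_left (abs_sum_average_inner_pow_sub_le hR hη μ ν x n
          (h n (Finset.mem_range.1 hn))) (by positivity)).trans_eq ?_
        rw [mul_pow (2 * Real.pi)]; ring
    _ ≤ _ := by
        rw [← Finset.mul_sum]
        exact mul_le_mul_of_nonneg_left (Real.sum_le_exp_of_nonneg (by positivity) l) hη

theorem abs_standardMixturePdf_sub_le {k d : ℕ} {R η : ℝ} (hR : 0 < R) (hη : 0 ≤ η) (l : ℕ)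
    {μ ν : Fin k → EuclideanSpace ℝ (Fin d)} (hμ : IsBoundedMixture R μ)
    (hν : IsBoundedMixture R ν) (x : EuclideanSpace ℝ (Fin d))
    (h : ∀ n < l, ∀ a : Sym (Fin d) n, |gaussMoment R μ a - gaussMoment R ν a| ≤ η) :
    |standardMixturePdf μ x - standardMixturePdf ν x|
      ≤ (2 * (1 / 2) ^ l * Real.exp (8 * Real.pi * R ^ 2)
          + η * Real.exp (2 * Real.pi * (R ^ 2 * d))) * Real.exp (-(Real.pi / 2) * ‖x‖ ^ 2) := by
  rw [standardMixturePdf_eq, standardMixturePdf_eq, ← mul_sub, abs_mul, Real.abs_exp]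
  have h1 := abs_average_sub_mixtureTaylor_le l hμ x
  have h2 := abs_average_sub_mixtureTaylor_le l hν x
  have h3 := abs_mixtureTaylor_sub_le hR hη l μ ν x h
  have key : ∀ a b : ℝ, -Real.pi * ‖x‖ ^ 2 + a ≤ b + -(Real.pi / 2) * ‖x‖ ^ 2 →
      Real.exp (-Real.pi * ‖x‖ ^ 2) * Real.exp a
        ≤ Real.exp b * Real.exp (-(Real.pi / 2) * ‖x‖ ^ 2) := fun a b hab => by
    rw [← Real.exp_add, ← Real.exp_add]; exact Real.exp_le_exp.2 hab
  -- Completing the square: half of the Gaussian exponent absorbs the growth linear in `‖x‖`, here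
  -- and in `k2`.
  have k1 := key (4 * Real.pi * R * ‖x‖) (8 * Real.pi * R ^ 2) (by
    have := mul_nonneg Real.pi_pos.le (sq_nonneg (‖x‖ - 4 * R)); linarith)
  have k2 := key (2 * Real.pi * (R * Real.sqrt d * ‖x‖)) (2 * Real.pi * (R ^ 2 * d)) (by
    have := mul_nonneg Real.pi_pos.le (sq_nonneg (‖x‖ - 2 * (R * Real.sqrt d)))
    have hd : (R * Real.sqrt d) ^ 2 = R ^ 2 * d := by
      rw [mul_pow, Real.sq_sqrt (Nat.cast_nonneg d)]
    rw [← hd]; linarith)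
  refine (mul_le_mul_of_nonneg_left (?_ : _ ≤ 2 * ((1 / 2) ^ l * Real.exp (4 * Real.pi * R * ‖x‖))
    + η * Real.exp (2 * Real.pi * (R * Real.sqrt d * ‖x‖))) (Real.exp_pos _).le).trans ?_
  · rw [abs_le] at h1 h2 h3 ⊢
    constructor <;> linarith [h1.1, h1.2, h2.1, h2.2, h3.1, h3.2]
  · have k1' := mul_le_mul_of_nonneg_left k1 (by positivity : (0 : ℝ) ≤ 2 * (1 / 2) ^ l)
    have k2' := mul_le_mul_of_nonneg_left k2 hη
    linarith

theorem eLpNorm_standardMixturePdf_sub_le {k d : ℕ} {R η : ℝ} (hR : 0 < R) (hη : 0 ≤ η) (l : ℕ)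
    {μ ν : Fin k → EuclideanSpace ℝ (Fin d)} (hμ : IsBoundedMixture R μ)
    (hν : IsBoundedMixture R ν)
    (h : ∀ n < l, ∀ a : Sym (Fin d) n, |gaussMoment R μ a - gaussMoment R ν a| ≤ η) :
    eLpNorm (standardMixturePdf μ - standardMixturePdf ν) 1 volume
      ≤ ENNReal.ofReal ((2 * (1 / 2) ^ l * Real.exp (8 * Real.pi * R ^ 2)
          + η * Real.exp (2 * Real.pi * (R ^ 2 * d))) * 2 ^ d) := by
  set K := 2 * (1 / 2) ^ l * Real.exp (8 * Real.pi * R ^ 2)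
          + η * Real.exp (2 * Real.pi * (R ^ 2 * d)) with hK
  have hK0 : 0 ≤ K := by positivity
  have hb : (0 : ℝ) < Real.pi / 2 := by positivity
  have hI := GaussianFourier.integral_rexp_neg_mul_sq_norm (V := EuclideanSpace ℝ (Fin d)) hb
  have hval : (Real.pi / (Real.pi / 2)) ^
      (Module.finrank ℝ (EuclideanSpace ℝ (Fin d)) / 2 : ℝ) ≤ 2 ^ d := by
    rw [div_div_cancel₀ Real.pi_ne_zero, finrank_euclideanSpace_fin, ← Real.rpow_natCast]
    refine Real.rpow_le_rpow_of_exponent_le one_le_two ?_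
    have : (0 : ℝ) ≤ d := Nat.cast_nonneg d
    linarith
  have hint : Integrable
      (fun x : EuclideanSpace ℝ (Fin d) => Real.exp (-(Real.pi / 2) * ‖x‖ ^ 2)) := by
    -- The integral of a non-integrable function is 0 by convention, so a nonzero value yields
    -- integrability.
    refine Integrable.of_integral_ne_zero ?_
    rw [hI]
    positivity
  rw [eLpNorm_one_eq_lintegral_enorm]
  calc _ ≤ ∫⁻ x : EuclideanSpace ℝ (Fin d),
          ENNReal.ofReal (K * Real.exp (-(Real.pi / 2) * ‖x‖ ^ 2)) := by
        refine lintegral_mono fun x => ?_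
        rw [Pi.sub_apply, Real.enorm_eq_ofReal_abs]
        exact ENNReal.ofReal_le_ofReal (abs_standardMixturePdf_sub_le hR hη l hμ hν x h)
    _ = ENNReal.ofReal (∫ x : EuclideanSpace ℝ (Fin d),
          K * Real.exp (-(Real.pi / 2) * ‖x‖ ^ 2)) :=
        (ofReal_integral_eq_lintegral_ofReal (hint.const_mul K)
          (Filter.Eventually.of_forall fun x => by positivity)).symm
    _ ≤ _ := by
        refine ENNReal.ofReal_le_ofReal ?_
        rw [integral_const_mul, hI]
        exact mul_le_mul_of_nonneg_left hval hK0

/-! ### Small-ball probabilities for random means -/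

section SmallBall

open scoped ENNReal

theorem cond_closedBall_ball_le {d : ℕ} (hd : 0 < d) {R s : ℝ} (hR : 0 < R) (hs : 0 ≤ s)
    (a : EuclideanSpace ℝ (Fin d)) :
    ProbabilityTheory.cond volume (Metric.closedBall (0 : EuclideanSpace ℝ (Fin d)) R)
      (Metric.ball a s) ≤ ENNReal.ofReal ((s / R) ^ d) := by
  have : Nonempty (Fin d) := ⟨⟨0, hd⟩⟩
  rw [ProbabilityTheory.cond_apply measurableSet_closedBall]
  refine (mul_le_mul_right (measure_mono Set.inter_subset_right) _).trans ?_
  rw [Measure.addHaar_closedBall _ _ hR.le, Measure.addHaar_ball _ _ hs,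
    finrank_euclideanSpace_fin, div_pow, ENNReal.ofReal_div_of_pos (by positivity), mul_comm,
    ← div_eq_mul_inv]
  exact (ENNReal.mul_div_mul_right _ _ (Metric.measure_ball_pos _ _ one_pos).ne'
    measure_ball_lt_top.ne).le

theorem isProbabilityMeasure_cond_closedBall {d : ℕ} {R : ℝ} (hR : 0 < R) :
    IsProbabilityMeasure (ProbabilityTheory.cond volume
      (Metric.closedBall (0 : EuclideanSpace ℝ (Fin d)) R)) :=
  ProbabilityTheory.cond_isProbabilityMeasure_of_finite
    (Metric.measure_closedBall_pos _ _ hR).ne' measure_closedBall_lt_top.ne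

variable {k d : ℕ}

/-- By independence the pair has a product law; conditionally on one mean, the other must hit a
fixed ball. -/
theorem measure_pi_dist_lt_le {ν : Measure (EuclideanSpace ℝ (Fin d))} [IsProbabilityMeasure ν]
    {s : ℝ} {c : ℝ≥0∞} (hc : ∀ a, ν (Metric.ball a s) ≤ c) {i j : Fin k} (hij : i ≠ j) :
    Measure.pi (fun _ : Fin k => ν) {μ | ‖μ i - μ j‖ < s} ≤ c := by
  have hmi : ∀ i : Fin k, Measurable fun μ : Fin k → EuclideanSpace ℝ (Fin d) => μ i :=
    measurable_pi_apply
  have hmap_eval : ∀ i : Fin k, (Measure.pi fun _ : Fin k => ν).map (fun μ => μ i) = ν :=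
    fun i => (measurePreserving_eval (fun _ : Fin k => ν) i).map_eq
  have hind : ProbabilityTheory.IndepFun (fun μ : Fin k → EuclideanSpace ℝ (Fin d) => μ i)
      (fun μ => μ j) (Measure.pi fun _ : Fin k => ν) :=
    (ProbabilityTheory.iIndepFun_pi (μ := fun _ : Fin k => ν)
      (X := fun _ => id) (fun _ => aemeasurable_id)).indepFun hij
  rw [ProbabilityTheory.indepFun_iff_map_prod_eq_prod_map_map
    (hmi i).aemeasurable (hmi j).aemeasurable, hmap_eval, hmap_eval] at hind
  have hm : MeasurableSet {p : EuclideanSpace ℝ (Fin d) × EuclideanSpace ℝ (Fin d) |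
      ‖p.1 - p.2‖ < s} := measurableSet_lt (by fun_prop) measurable_const
  have hmap := congrArg (fun m => m {p : EuclideanSpace ℝ (Fin d) × EuclideanSpace ℝ (Fin d) |
      ‖p.1 - p.2‖ < s}) hind
  rw [Measure.map_apply ((hmi i).prodMk (hmi j)) hm,
    Measure.prod_apply hm] at hmap
  refine hmap.trans_le ?_
  calc _ ≤ ∫⁻ _, c ∂ν := by
        refine lintegral_mono fun a => (measure_mono ?_).trans (hc a)
        intro b hb
        rw [Metric.mem_ball, dist_comm, dist_eq_norm]
        exact hb
    _ = c := by simp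

theorem measure_pi_not_isSeparatedMixture_le {ν : Measure (EuclideanSpace ℝ (Fin d))}
    [IsProbabilityMeasure ν] {s : ℝ} {c : ℝ≥0∞} (hc : ∀ a, ν (Metric.ball a s) ≤ c) :
    Measure.pi (fun _ : Fin k => ν) {μ | ¬ IsSeparatedMixture s μ} ≤ (k : ℝ≥0∞) ^ 2 * c := by
  calc _ ≤ Measure.pi (fun _ : Fin k => ν)
          (⋃ p : Fin k × Fin k, if p.1 = p.2 then ∅ else {μ | ‖μ p.1 - μ p.2‖ < s}) := by
        refine measure_mono fun μ hμ => ?_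
        simp only [IsSeparatedMixture, Set.mem_ofPred_eq, not_forall, not_le] at hμ
        obtain ⟨i, j, hij, h⟩ := hμ
        refine Set.mem_iUnion.2 ⟨(i, j), ?_⟩
        rw [if_neg hij]
        exact h
    _ ≤ ∑ p : Fin k × Fin k, Measure.pi (fun _ : Fin k => ν)
          (if p.1 = p.2 then ∅ else {μ | ‖μ p.1 - μ p.2‖ < s}) := measure_iUnion_fintype_le _ _
    _ ≤ ∑ _p : Fin k × Fin k, c := by
        refine Finset.sum_le_sum fun p _ => ?_
        split_ifs with h
        · simp
        · exact measure_pi_dist_lt_le hc h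
    _ = (k : ℝ≥0∞) ^ 2 * c := by simp [sq]

/-- Union bound over matchings: a matching of cost below `s` has every single summand below `s`,
which confines each of the `k` independent means to its own ball. -/
theorem measure_pi_paramDist_lt_le {ν : Measure (EuclideanSpace ℝ (Fin d))}
    [IsProbabilityMeasure ν] {s : ℝ} {c : ℝ≥0∞} (hc : ∀ a, ν (Metric.ball a s) ≤ c)
    (μ : Fin k → EuclideanSpace ℝ (Fin d)) :
    Measure.pi (fun _ : Fin k => ν) {μ' | paramDist μ μ' < s}
      ≤ (k.factorial : ℝ≥0∞) * c ^ k := by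
  calc _ ≤ Measure.pi (fun _ : Fin k => ν) (⋃ π : Equiv.Perm (Fin k),
          Set.univ.pi fun i => Metric.ball (μ (π.symm i)) s) := by
        refine measure_mono fun μ' hμ' => ?_
        rw [Set.mem_ofPred_eq, paramDist, Finset.inf'_lt_iff] at hμ'
        obtain ⟨π, -, hπ⟩ := hμ'
        refine Set.mem_iUnion.2 ⟨π, fun i _ => ?_⟩
        rw [Metric.mem_ball, dist_comm, dist_eq_norm]
        refine lt_of_le_of_lt ?_ hπ
        have := Finset.single_le_sum (f := fun j => ‖μ j - μ' (π j)‖)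
          (fun j _ => norm_nonneg _) (Finset.mem_univ (π.symm i))
        simpa using this
    _ ≤ ∑ π : Equiv.Perm (Fin k), Measure.pi (fun _ : Fin k => ν)
          (Set.univ.pi fun i => Metric.ball (μ (π.symm i)) s) := measure_iUnion_fintype_le _ _
    _ ≤ ∑ _π : Equiv.Perm (Fin k), c ^ k := by
        refine Finset.sum_le_sum fun π _ => ?_
        rw [Measure.pi_pi]
        refine (Finset.prod_le_prod' fun i _ => hc _).trans_eq ?_
        simp
    _ = (k.factorial : ℝ≥0∞) * c ^ k := by simp [Fintype.card_perm]

theorem measure_pi_not_isBoundedMixture {R : ℝ} (hR : 0 < R) :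
    Measure.pi (fun _ : Fin k => ProbabilityTheory.cond volume
      (Metric.closedBall (0 : EuclideanSpace ℝ (Fin d)) R)) {μ | ¬ IsBoundedMixture R μ} = 0 := by
  have := isProbabilityMeasure_cond_closedBall (d := d) hR
  refine measure_mono_null (t := ⋃ j, Function.eval j ⁻¹'
    (Metric.closedBall (0 : EuclideanSpace ℝ (Fin d)) R)ᶜ) (fun μ hμ => ?_) ?_
  · simp only [IsBoundedMixture, Set.mem_ofPred_eq, not_forall] at hμ
    obtain ⟨j, hj⟩ := hμ
    exact Set.mem_iUnion.2 ⟨j, by simpa using hj⟩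
  · refine measure_iUnion_null fun j => ?_
    rw [(measurePreserving_eval _ j).measure_preimage
      measurableSet_closedBall.compl.nullMeasurableSet,
      ProbabilityTheory.cond_apply measurableSet_closedBall, Set.inter_compl_self]
    simp

end SmallBall

/-! ### Pigeonhole over moment cells -/

open scoped ENNReal in
/-- If every set `N ω` has measure at most `ε` and `F` takes few values on `T`, then most `ω ∈ T`
share their value of `F` with a point of `T` outside `N ω`. -/
theorem measure_exists_same_value_not_mem {Ω κ : Type*} [MeasurableSpace Ω] (P : Measure Ω)
    [IsProbabilityMeasure P] {T : Set Ω} {F : Ω → κ} {S : Finset κ} (hF : ∀ ω ∈ T, F ω ∈ S)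
    {N : Ω → Set Ω} {ε δ : ℝ≥0∞} (hN : ∀ ω, P (N ω) ≤ ε) (hT : P Tᶜ ≤ δ) :
    1 - (δ + S.card * ε) ≤ P {ω | ω ∈ T ∧ ∃ ω' ∈ T, F ω' = F ω ∧ ω' ∉ N ω} := by
  classical
  set G := {ω | ω ∈ T ∧ ∃ ω' ∈ T, F ω' = F ω ∧ ω' ∉ N ω} with hG
  -- If a point of `T` has no partner, its whole cell lies in `N ω`, hence is light. Only
  -- subadditivity is used, so no measurability is needed.
  have hsub : Gᶜ ⊆ Tᶜ ∪ ⋃ c ∈ S.filter (fun c => P (T ∩ F ⁻¹' {c}) ≤ ε), T ∩ F ⁻¹' {c} := by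
    intro ω hω
    by_cases hωT : ω ∈ T
    · right
      refine Set.mem_biUnion (x := F ω) ?_ ⟨hωT, rfl⟩
      refine Finset.mem_coe.2 (Finset.mem_filter.2 ⟨hF ω hωT, (measure_mono ?_).trans (hN ω)⟩)
      rintro ω' ⟨h1, h2⟩
      by_contra h3
      exact hω ⟨hωT, ω', h1, h2, h3⟩
    · exact Or.inl hωT
  have hle : P Gᶜ ≤ δ + S.card * ε := by
    refine (measure_mono hsub).trans ((measure_union_le _ _).trans (add_le_add hT ?_))
    refine (measure_biUnion_finset_le _ _).trans ?_
    refine (Finset.sum_le_card_nsmul _ _ ε fun c hc => (Finset.mem_filter.1 hc).2).trans ?_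
    rw [nsmul_eq_mul]
    gcongr
    exact Finset.filter_subset _ _
  rw [tsub_le_iff_right, ← measure_univ (μ := P), ← Set.union_compl_self G]
  exact (measure_union_le _ _).trans (by gcongr)

/-- The hockey-stick identity, whose sum also contains the degree `l`, dropped here. -/
theorem card_sigma_sym_le (d l : ℕ) :
    Fintype.card (Σ n : Fin l, Sym (Fin d) n) ≤ (l + d).choose d := by
  rw [Fintype.card_sigma, ← Nat.sum_range_multichoose, Finset.sum_range_succ]
  simp only [Sym.card_sym_eq_multichoose, Fintype.card_fin]
  rw [Fin.sum_univ_eq_sum_range (fun n => Nat.multichoose d n)]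
  exact Nat.le_add_right _ _

theorem choose_mul_add_le (d A : ℕ) :
    (((A * d + d).choose d : ℕ) : ℝ) ≤ (((A : ℝ) + 1) * Real.exp 1) ^ d := by
  have h := Nat.choose_le_pow_div (α := ℝ) d (A * d + d)
  have h2 := Real.pow_div_factorial_le_exp (d : ℝ) (Nat.cast_nonneg d) d
  calc _ ≤ _ := h
    _ = ((A : ℝ) + 1) ^ d * ((d : ℝ) ^ d / (d.factorial : ℝ)) := by
        push_cast
        rw [← mul_div_assoc, ← mul_pow]; ring
    _ ≤ ((A : ℝ) + 1) ^ d * Real.exp d := by gcongr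
    _ = _ := by rw [mul_pow, ← Real.exp_nat_mul, mul_one]

/-- With high probability a random mixture is indistinguishable up to `τ` from a mixture far from it
in parameter distance, as soon as small balls are light compared to the number of moment cells. -/
theorem ofReal_le_randomMeans {k d l : ℕ} (hk : 0 < k) (hd : 0 < d) {s r Q τ : ℝ} (hs : 0 ≤ s)
    (hr0 : 0 ≤ r) (hQ : 0 < Q) (hr : (s / Real.sqrt d) ^ d ≤ r) (hsep : (k : ℝ) ^ 2 * r ≤ 1 / k)
    (hcells : (2 * (⌈Q⌉₊ : ℝ) + 1) ^ Fintype.card (Σ n : Fin l, Sym (Fin d) n)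
      * ((k.factorial : ℝ) * r ^ k) ≤ 1 / k)
    (hτ : (2 * (1 / 2) ^ l * Real.exp (8 * Real.pi * d)
          + Q⁻¹ * Real.exp (2 * Real.pi * ((d : ℝ) * d))) * 2 ^ d ≤ τ) :
    ENNReal.ofReal (1 - 2 / (k : ℝ)) ≤
      randomMeans k d {μ : Fin k → EuclideanSpace ℝ (Fin d) |
        ∃ μ' : Fin k → EuclideanSpace ℝ (Fin d),
          IsBoundedMixture (Real.sqrt d) μ ∧ IsBoundedMixture (Real.sqrt d) μ' ∧
          IsSeparatedMixture s μ ∧ IsSeparatedMixture s μ' ∧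
          eLpNorm (standardMixturePdf μ - standardMixturePdf μ') 1 volume ≤ ENNReal.ofReal τ ∧
          s ≤ paramDist μ μ'} := by
  have hR : 0 < Real.sqrt d := Real.sqrt_pos.2 (Nat.cast_pos.2 hd)
  have hR2 : Real.sqrt d ^ 2 = d := Real.sq_sqrt (Nat.cast_nonneg d)
  have hkR : (0 : ℝ) < k := Nat.cast_pos.2 hk
  have := isProbabilityMeasure_cond_closedBall (d := d) hR
  have hball := fun a => (cond_closedBall_ball_le hd hR hs a).trans (ENNReal.ofReal_le_ofReal hr)
  have hP : IsProbabilityMeasure (randomMeans k d) := by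
    rw [randomMeans]; infer_instance
  set T : Set (Fin k → EuclideanSpace ℝ (Fin d)) :=
    {μ | IsBoundedMixture (Real.sqrt d) μ ∧ IsSeparatedMixture s μ} with hT
  let F : (Fin k → EuclideanSpace ℝ (Fin d)) → (Σ n : Fin l, Sym (Fin d) n) → ℤ :=
    fun μ p => ⌊Q * gaussMoment (Real.sqrt d) μ p.2⌋
  let S : Finset ((Σ n : Fin l, Sym (Fin d) n) → ℤ) :=
    Fintype.piFinset fun _ => Finset.Icc (-(⌈Q⌉₊ : ℤ)) ⌈Q⌉₊
  have hS : (S.card : ℝ) = (2 * (⌈Q⌉₊ : ℝ) + 1) ^ Fintype.card (Σ n : Fin l, Sym (Fin d) n) := by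
    have : ((⌈Q⌉₊ : ℤ) + 1 - -(⌈Q⌉₊ : ℤ)).toNat = 2 * ⌈Q⌉₊ + 1 := by omega
    simp only [S, Fintype.card_piFinset, Int.card_Icc, Finset.prod_const, Finset.card_univ, this]
    push_cast
    rfl
  have hF : ∀ μ ∈ T, F μ ∈ S := by
    intro μ hμ
    refine Fintype.mem_piFinset.2 fun p => Finset.mem_Icc.2 ?_
    have h1 := abs_le.1 (abs_gaussMoment_le_one hR hμ.1 p.2)
    have h2 := Nat.le_ceil Q
    constructor
    · rw [Int.le_floor]
      push_cast
      nlinarith [h1.1]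
    · refine Int.cast_le (R := ℝ).1 ((Int.floor_le _).trans ?_)
      push_cast
      nlinarith [h1.2]
  have hTc : randomMeans k d Tᶜ ≤ ENNReal.ofReal (1 / k) := by
    have hsub : Tᶜ ⊆ {μ | ¬ IsBoundedMixture (Real.sqrt d) μ} ∪ {μ | ¬ IsSeparatedMixture s μ} :=
      fun μ hμ => not_and_or.1 hμ
    refine (measure_mono hsub).trans ((measure_union_le _ _).trans ?_)
    rw [randomMeans, measure_pi_not_isBoundedMixture hR, zero_add]
    refine (measure_pi_not_isSeparatedMixture_le hball).trans ?_
    rw [← ENNReal.ofReal_natCast, ← ENNReal.ofReal_pow hkR.le, ← ENNReal.ofReal_mul (by positivity)]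
    exact ENNReal.ofReal_le_ofReal hsep
  have hmain := measure_exists_same_value_not_mem (randomMeans k d) hF
    (fun μ => measure_pi_paramDist_lt_le hball μ) hTc
  refine le_trans ?_ (hmain.trans (measure_mono ?_))
  · have hle : (S.card : ENNReal) * ((k.factorial : ENNReal) * ENNReal.ofReal r ^ k)
        ≤ ENNReal.ofReal (1 / k) := by
      rw [← ENNReal.ofReal_pow hr0, ← ENNReal.ofReal_natCast, ← ENNReal.ofReal_natCast,
        ← ENNReal.ofReal_mul (by positivity), ← ENNReal.ofReal_mul (by positivity), hS]
      exact ENNReal.ofReal_le_ofReal hcells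
    refine le_trans ?_ (tsub_le_tsub_left (add_le_add_right hle _) 1)
    rw [← ENNReal.ofReal_add (by positivity) (by positivity), ← ENNReal.ofReal_one,
      ← ENNReal.ofReal_sub _ (by positivity)]
    refine ENNReal.ofReal_le_ofReal (le_of_eq ?_)
    ring
  · rintro μ ⟨hμ, μ', hμ', hFe, hN⟩
    refine ⟨μ', hμ.1, hμ'.1, hμ.2, hμ'.2, ?_, not_lt.1 hN⟩
    refine (eLpNorm_standardMixturePdf_sub_le hR (inv_nonneg.2 hQ.le) l hμ.1 hμ'.1 ?_).trans
      (ENNReal.ofReal_le_ofReal (by rwa [hR2]))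
    intro n hn a
    -- Equal floors put the moments within `Q⁻¹` of each other, which is the `η` used above.
    have h1 := Int.abs_sub_lt_one_of_floor_eq_floor (congrFun hFe ⟨⟨n, hn⟩, a⟩).symm
    rw [← mul_sub, abs_mul, abs_of_pos hQ] at h1
    rw [← one_div, le_div_iff₀ hQ, mul_comm]
    exact h1.le

/-! ### Choice of parameters, with `C = exp t` and `κ = log k` -/

section Parameters

variable {t : ℝ}

theorem mul_le_exp_half (ht : 400 ≤ t) : 42 * t ≤ Real.exp (t / 2) := by
  have h := Real.quadratic_le_exp_of_nonneg (x := t / 2) (by linarith)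
  nlinarith

/-- The bounds on the dimension `d` in terms of the number of components `k`. -/
theorem dimension_bounds (ht : 400 ≤ t) {κ : ℝ} {d : ℕ} (hκ : 8 * t ≤ κ)
    (hd : |(d : ℝ) - 1 / (4 * t) * κ| < 1) :
    2 ≤ d ∧ κ ≤ 6 * t * d ∧ 5 / 2 * t * d ≤ κ := by
  have ht0 : 0 < t := by linarith
  set L := 1 / (4 * t) * κ with hL
  have hκL : κ = 4 * t * L := by rw [hL]; field_simp
  have hL2 : 2 ≤ L := by
    by_contra! h
    nlinarith
  rw [abs_lt] at hd
  have hd2 : 2 ≤ d := by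
    have : (1 : ℝ) < d := by linarith
    exact_mod_cast this
  have hd2' : (2 : ℝ) ≤ d := by exact_mod_cast hd2
  refine ⟨hd2, ?_, ?_⟩
  · nlinarith
  -- For `d = 2, 3` the bound `2 ≤ L` suffices; from `d = 4` on, `d - 1 < L` does.
  · have key : 5 / 2 * (d : ℝ) ≤ 4 * L := by
      rcases hd2.eq_or_lt with rfl | h3
      · push_cast; linarith
      · rcases (Nat.succ_le_of_lt h3).eq_or_lt with h | h4
        · rw [← h]; push_cast; linarith
        · have : (4 : ℝ) ≤ d := by exact_mod_cast h4
          linarith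
    nlinarith

theorem small_ball_bound (ht : 400 ≤ t) {κ : ℝ} {d : ℕ} (hd : 2 ≤ d) (hκ : κ ≤ 6 * t * d) :
    (1 / Real.exp t ^ 24 * Real.sqrt κ / Real.sqrt d) ^ d ≤ Real.exp (-(23 * t * d)) := by
  have hd0 : (0 : ℝ) < d := by positivity
  have hs : Real.sqrt κ ≤ Real.exp t * Real.sqrt d := by
    refine Real.sqrt_le_iff.2 ⟨by positivity, ?_⟩
    rw [mul_pow, Real.sq_sqrt hd0.le]
    refine hκ.trans (mul_le_mul_of_nonneg_right ?_ hd0.le)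
    nlinarith [Real.add_one_le_exp t]
  have h : 1 / Real.exp t ^ 24 * Real.sqrt κ / Real.sqrt d ≤ Real.exp (-(23 * t)) := by
    rw [div_le_iff₀ (Real.sqrt_pos.2 hd0)]
    calc _ ≤ 1 / Real.exp t ^ 24 * (Real.exp t * Real.sqrt d) := by gcongr
      _ = Real.exp (-(23 * t)) * Real.sqrt d := by
        rw [← mul_assoc]
        congr 1
        rw [← Real.exp_nat_mul, one_div, ← Real.exp_neg, ← Real.exp_add]
        congr 1; push_cast; ring
  calc _ ≤ Real.exp (-(23 * t)) ^ d := by gcongr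
    _ = _ := by rw [← Real.exp_nat_mul]; congr 1; ring

/-- The target exponent is at most `6 * t * d * exp t`. The Taylor error supplies 8 in place of 6
(12 times 2/3, as `log 2 > 2/3`) and the rounding error supplies 7; the term `t * d * d` in `Q`
absorbs `exp (2π d²)`. -/
theorem density_bound (ht : 400 ≤ t) {κ : ℝ} {d l : ℕ} (hd : 2 ≤ d) (hκ : κ ≤ 6 * t * d)
    (hl : 12 * Real.exp t * t * d ≤ l) :
    (2 * (1 / 2) ^ l * Real.exp (8 * Real.pi * d)
      + (Real.exp (t * (7 * d * Real.exp t + d * d)))⁻¹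
        * Real.exp (2 * Real.pi * ((d : ℝ) * d))) * 2 ^ d ≤ Real.exp (-(κ * Real.exp t)) := by
  have hd' : (2 : ℝ) ≤ d := by exact_mod_cast hd
  have hC : 401 ≤ Real.exp t := by linarith [Real.add_one_le_exp t]
  have h2 : (2 : ℝ) ≤ Real.exp 1 := by linarith [Real.add_one_le_exp 1]
  have h2d : (2 : ℝ) ^ d ≤ Real.exp d := by
    calc (2 : ℝ) ^ d ≤ Real.exp 1 ^ d := by gcongr
      _ = _ := by rw [← Real.exp_nat_mul, mul_one]
  have hhalf : (1 / 2 : ℝ) ^ l ≤ Real.exp (-(8 * Real.exp t * t * d)) := by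
    have hb : (1 / 2 : ℝ) ≤ Real.exp (-(2 / 3)) := by
      rw [← Real.log_le_iff_le_exp (by norm_num), one_div, Real.log_inv]
      linarith [Real.log_two_gt_d9]
    calc (1 / 2 : ℝ) ^ l ≤ Real.exp (-(2 / 3)) ^ l := by gcongr
      _ = Real.exp (l * -(2 / 3)) := by rw [← Real.exp_nat_mul]
      _ ≤ _ := Real.exp_le_exp.2 (by linarith)
  have hpi := Real.pi_lt_d2
  have hpi0 := Real.pi_pos
  have hκC : κ * Real.exp t ≤ 6 * t * d * Real.exp t :=
    mul_le_mul_of_nonneg_right hκ (Real.exp_pos t).le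
  have htd : 400 * (d : ℝ) ≤ t * d := by nlinarith
  have htdC : 401 * (t * d) ≤ t * d * Real.exp t := by nlinarith
  have hdd : 2 * (d : ℝ) ≤ d * d := by nlinarith
  have htdd : 400 * ((d : ℝ) * d) ≤ t * (d * d) := by nlinarith
  have hpd : Real.pi * d ≤ 3.15 * d := by nlinarith
  have hpdd : Real.pi * (d * d) ≤ 3.15 * (d * d) := by nlinarith
  have e1 : 2 * (1 / 2) ^ l * Real.exp (8 * Real.pi * d) * 2 ^ d * 2
      ≤ Real.exp (-(κ * Real.exp t)) := by
    calc 2 * (1 / 2) ^ l * Real.exp (8 * Real.pi * d) * 2 ^ d * 2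
        ≤ Real.exp 1 * Real.exp (-(8 * Real.exp t * t * d)) * Real.exp (8 * Real.pi * d)
          * Real.exp d * Real.exp 1 := by gcongr
      _ = Real.exp (1 + -(8 * Real.exp t * t * d) + 8 * Real.pi * d + d + 1) := by
          simp only [Real.exp_add]
      _ ≤ _ := Real.exp_le_exp.2 (by linarith)
  have e2 : (Real.exp (t * (7 * d * Real.exp t + d * d)))⁻¹
        * Real.exp (2 * Real.pi * ((d : ℝ) * d)) * 2 ^ d * 2 ≤ Real.exp (-(κ * Real.exp t)) := by
    calc _ ≤ Real.exp (-(t * (7 * d * Real.exp t + d * d)))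
        * Real.exp (2 * Real.pi * ((d : ℝ) * d)) * Real.exp d * Real.exp 1 := by
          rw [← Real.exp_neg]; gcongr
      _ = Real.exp (-(t * (7 * d * Real.exp t + d * d)) + 2 * Real.pi * ((d : ℝ) * d) + d + 1) := by
          simp only [Real.exp_add]
      _ ≤ _ := Real.exp_le_exp.2 (by linarith)
  linarith

/-- The exponent 3/2 leaves a factor `exp (t * d)` below `k ≥ exp (5/2 * t * d)`, room for the
logarithm of the number of values per moment. -/
theorem card_moments_le (ht : 400 ≤ t) (d : ℕ) :
    (Fintype.card (Σ n : Fin (⌈12 * Real.exp t * t⌉₊ * d), Sym (Fin d) n) : ℝ)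
      ≤ Real.exp (3 / 2 * t * d) := by
  refine (Nat.cast_le.2 (card_sigma_sym_le d _)).trans ((choose_mul_add_le d _).trans ?_)
  have hC : 401 ≤ Real.exp t := by linarith [Real.add_one_le_exp t]
  have hA : (⌈12 * Real.exp t * t⌉₊ : ℝ) < 12 * Real.exp t * t + 1 :=
    Nat.ceil_lt_add_one (by positivity)
  have hbase : ((⌈12 * Real.exp t * t⌉₊ : ℝ) + 1) * Real.exp 1 ≤ Real.exp (3 / 2 * t) := by
    calc _ ≤ (14 * Real.exp t * t) * 3 := by
          refine mul_le_mul ?_ (Real.exp_one_lt_d9.le.trans (by norm_num)) (Real.exp_pos _).le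
            (by positivity)
          nlinarith
      _ = Real.exp t * (42 * t) := by ring
      _ ≤ Real.exp t * Real.exp (t / 2) := by gcongr; exact mul_le_exp_half ht
      _ = _ := by rw [← Real.exp_add]; congr 1; ring
  calc _ ≤ Real.exp (3 / 2 * t) ^ d := by gcongr
    _ = _ := by rw [← Real.exp_nat_mul]; congr 1; ring

theorem cells_bound (ht : 400 ≤ t) {κ : ℝ} {k d M : ℕ} (hd : 2 ≤ d) (hk : (k : ℝ) = Real.exp κ)
    (hκ : κ ≤ 6 * t * d) (hκ' : 5 / 2 * t * d ≤ κ) (hM : (M : ℝ) ≤ Real.exp (3 / 2 * t * d)) :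
    (2 * (⌈Real.exp (t * (7 * d * Real.exp t + d * d))⌉₊ : ℝ) + 1) ^ M
      * ((k.factorial : ℝ) * Real.exp (-(23 * t * d)) ^ k) ≤ 1 / k := by
  have hd' : (2 : ℝ) ≤ d := by exact_mod_cast hd
  have hC : 401 ≤ Real.exp t := by linarith [Real.add_one_le_exp t]
  set q := t * (7 * d * Real.exp t + d * d) with hq
  have hq0 : 0 ≤ q := by positivity
  have hcell : 2 * (⌈Real.exp q⌉₊ : ℝ) + 1 ≤ Real.exp (t + q) := by
    have h1 := Nat.ceil_lt_add_one (Real.exp_pos q).le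
    have h2 := Real.one_le_exp hq0
    rw [Real.exp_add]
    nlinarith
  have hfac : (k.factorial : ℝ) ≤ Real.exp (k * κ) := by
    rw [Real.exp_nat_mul, ← hk]
    exact_mod_cast Nat.factorial_le_pow k
  have hE : d * (1 + 7 * Real.exp t + d) ≤ 9 * d * Real.exp (t * d) := by
    have h1 : Real.exp t ≤ Real.exp (t * d) := Real.exp_le_exp.2 (by nlinarith)
    have h2 : (d : ℝ) ≤ Real.exp (t * d) := by nlinarith [Real.add_one_le_exp (t * d)]
    nlinarith
  have hMk : (M : ℝ) * Real.exp (t * d) ≤ k := by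
    calc (M : ℝ) * Real.exp (t * d) ≤ Real.exp (3 / 2 * t * d) * Real.exp (t * d) := by gcongr
      _ = Real.exp (5 / 2 * t * d) := by rw [← Real.exp_add]; congr 1; ring
      _ ≤ k := by rw [hk]; exact Real.exp_le_exp.2 hκ'
  have hk1 : (1 : ℝ) ≤ k := by rw [hk]; exact Real.one_le_exp (by nlinarith)
  have hMq : (M : ℝ) * (t + q) ≤ 9 * (t * d * k) := by
    calc (M : ℝ) * (t + q) ≤ M * (t * (9 * d * Real.exp (t * d))) := by
          refine mul_le_mul_of_nonneg_left ?_ (Nat.cast_nonneg M)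
          rw [hq, ← mul_one_add]
          refine mul_le_mul_of_nonneg_left ?_ (by linarith)
          linarith
      _ = 9 * (t * d * (M * Real.exp (t * d))) := by ring
      _ ≤ _ := by
          refine mul_le_mul_of_nonneg_left (mul_le_mul_of_nonneg_left hMk ?_) (by norm_num)
          positivity
  have hkκ : (k : ℝ) * κ ≤ 6 * (t * d * k) := by nlinarith
  have hκk : κ ≤ 6 * (t * d * k) := by
    have : t * d ≤ t * d * k := le_mul_of_one_le_right (by positivity) hk1
    linarith
  -- In units of `t * d * k`, the cells cost 9, the factorial 6 and the target `1 / k` at most 6: 21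
  -- in all, against the gain of 23.
  calc _ ≤ Real.exp (t + q) ^ M * (Real.exp (k * κ) * Real.exp (-(23 * t * d)) ^ k) := by gcongr
    _ = Real.exp (M * (t + q) + (k * κ + k * -(23 * t * d))) := by
        rw [← Real.exp_nat_mul, ← Real.exp_nat_mul, ← Real.exp_add, ← Real.exp_add]
    _ ≤ Real.exp (-κ) := Real.exp_le_exp.2 (by
        have : 0 ≤ t * d * (k : ℝ) := by positivity
        linarith)
    _ = 1 / k := by rw [hk, Real.exp_neg, one_div]

end Parameters

theorem theorem4p1 :
    ∃ C₀ : ℝ, ∀ C : ℝ, C₀ ≤ C →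
      ∃ c c₂ : ℝ, 0 < c ∧ 0 < c₂ ∧ c = 1 / (4 * Real.log C) ∧ c₂ = 1 / C ^ 24 ∧
        ∀ k d : ℕ, C ^ 8 ≤ (k : ℝ) → |(d : ℝ) - c * Real.log k| < 1 →
          ENNReal.ofReal (1 - 2 / (k : ℝ)) ≤
            randomMeans k d {μ : Fin k → EuclideanSpace ℝ (Fin d) |
              ∃ μ' : Fin k → EuclideanSpace ℝ (Fin d),
                IsBoundedMixture (Real.sqrt d) μ ∧
                IsBoundedMixture (Real.sqrt d) μ' ∧
                IsSeparatedMixture (c₂ * Real.sqrt (Real.log k)) μ ∧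
                IsSeparatedMixture (c₂ * Real.sqrt (Real.log k)) μ' ∧
                eLpNorm (standardMixturePdf μ - standardMixturePdf μ') 1 volume
                  ≤ ENNReal.ofReal ((k : ℝ) ^ (-C)) ∧
                c₂ * Real.sqrt (Real.log k) ≤ paramDist μ μ'} := by
  refine ⟨Real.exp 400, fun C hC => ?_⟩
  have hC0 : 0 < C := (Real.exp_pos _).trans_le hC
  obtain ⟨t, rfl⟩ : ∃ t, Real.exp t = C := ⟨Real.log C, Real.exp_log hC0⟩
  have ht : 400 ≤ t := Real.exp_le_exp.1 hC
  have ht0 : 0 < t := by linarith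
  rw [Real.log_exp]
  refine ⟨1 / (4 * t), 1 / Real.exp t ^ 24, by positivity, by positivity, rfl, rfl, ?_⟩
  intro k d hk hd
  have hk0 : (0 : ℝ) < k := lt_of_lt_of_le (by positivity) hk
  have hkexp : (k : ℝ) = Real.exp (Real.log k) := (Real.exp_log hk0).symm
  have hκ : 8 * t ≤ Real.log k := by
    rw [Real.le_log_iff_exp_le hk0]
    refine le_trans (le_of_eq ?_) hk
    rw [← Real.exp_nat_mul]; norm_num
  obtain ⟨hd2, hκ1, hκ2⟩ := dimension_bounds ht hκ hd
  rw [show (k : ℝ) ^ (-Real.exp t) = Real.exp (-(Real.log k * Real.exp t)) by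
    rw [Real.rpow_def_of_pos hk0, mul_neg]]
  refine ofReal_le_randomMeans (l := ⌈12 * Real.exp t * t⌉₊ * d) (Nat.cast_pos.1 hk0) (by omega)
    (by positivity) (Real.exp_pos _).le (Real.exp_pos _) (small_ball_bound ht hd2 hκ1) ?_
    (cells_bound ht hd2 hkexp hκ1 hκ2 (card_moments_le ht d)) (density_bound ht hd2 hκ1 ?_)
  -- Separation needs `3 * log k ≤ 23 * t * d`, and `log k ≤ 6 * t * d`.
  · rw [one_div, ← Real.exp_log hk0, ← Real.exp_nat_mul, ← Real.exp_add, ← Real.exp_neg]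
    exact Real.exp_le_exp.2 (by push_cast; linarith)
  · push_cast
    exact mul_le_mul_of_nonneg_right (Nat.le_ceil _) (Nat.cast_nonneg d)
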